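/- **Model.** Let $T=[0,1]^d$ be the space of types. There are $m$ schools; school $j\in[m]$ has a capacity $c_j\in\mathbb N$, a bounded measurable value function $v_j:T\to\mathbb R_+$ and a measurable scoring function $s_j:T\to[0,1]$. There are $n\ge 1$ students. The set of actions $A$ consists of the preference lists containing at most $\ell=1$ school. For $(t_i,a_i)_{i\in[n]}\in(T\times A)^n$, the schools sort students by decreasing score $s_j(t_i)$, breaking ties uniformly at random, and students are assigned by student-proposing deferred acceptance with the lists $a_i$; student $i$ gets $v_j(t_i)$ if she is assigned to school $j$ and $0$ if she is unassigned. $\mathrm{Utility}((t_i,a_i)_{i\in[n]})\in\mathbb R_+^n$ is the vector of these utilities averaged over all tie-breaking choices. For a probability measure $\mu$ on $T$, let $\tilde{\mathcal S}_\mu$ be the set of probability measures on $T\times A$ whose marginal on $T$ is $\mu$, and let $\mathcal G_\mu$ be the $n$-player game in which every player chooses a $\tilde p_i\in\tilde{\mathcal S}_\mu$ and the payoff vector is $$\tilde U(\tilde p_1,\dots,\tilde p_n)=\mathbb E\big[\mathrm{Utility}((t_i,a_i)_{i\in[n]})\,\big|\,\text{all } t_i \text{ are distinct}\big],$$ where the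 $(t_i,a_i)$ are drawn independently from the $\tilde p_i$. A symmetric equilibrium of $\mathcal G_\mu$ is a $\tilde p\in\tilde{\mathcal S}_\mu$ such that the profile $(\tilde p,\dots,\tilde p)$ is a Nash equilibrium. The game is *strongly $\alpha$-reducible* if for every nonempty finite $S\subseteq T$ and every $q\in[0,1]^m$ there is a pair $(t,j)\in S\times[m]$ such that $s_j(t')\le s_j(t)$ for every $t'\in S$ and $q_{j'}v_{j'}(t)\le q_jv_j(t)$ for every $j'\in[m]$. **Algorithm.** Input: types $t_1,\dots,t_k\in T$. Let $$\mathrm{Proba}(x,c)=\sum_{i=0}^{c-1}\binom{x}{i}\binom{k-1-x}{n-1-i}\Big/\binom{k-1}{n-1},$$ where a binomial coefficient with a negative lower index is $0$. Start with all types unassigned and $x_j=0$ for all $j\in[m]$. While some types are unassigned, do the following for $j=1,\dots,m$ in turn: if some type is unassigned, let $i$ be the unassigned type that maximizes $s_j(t_i)$; if $v_{j'}(t_i)\,\mathrm{Proba}(x_{j'},c_{j'})\le v_j(t_i)\,\mathrm{Proba}(x_j,c_j)$ for every $j'\in[m]$, assign type $i$ to school $j$, set $a_i\leftarrow j$ and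 $x_j\leftarrow x_j+1$. When all types are assigned, return the distributional strategy $\mathrm{Uniform}\{(t_i,a_i)\}_{i\in[k]}$. **Theorem.** Let $k\ge n$, let $t_1,\dots,t_k\in T$ be such that every school gives distinct scores to them (for every $j$, the numbers $s_j(t_1),\dots,s_j(t_k)$ are pairwise distinct), and let $\mu_k$ be the uniform distribution over $(t_i)_{i\in[k]}$. If the game is strongly $\alpha$-reducible, then the algorithm terminates, and the strategy it returns is a symmetric equilibrium of the game $\mathcal G_{\mu_k}$. -/

import Mathlib

namespace SchoolChoice

open MeasureTheory

/-- The space of types `T = [0,1]^d`. -/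
abbrev TypeSpace (d : ℕ) : Type := Fin d → unitInterval

/-- Actions: preference lists (without repetition) containing at most `ℓ` of the `m` schools. -/
def Action (m ℓ : ℕ) : Type := {l : List (Fin m) // l.Nodup ∧ l.length ≤ ℓ}

/-- The (finite) set of actions carries the discrete σ-algebra. -/
instance (m ℓ : ℕ) : MeasurableSpace (Action m ℓ) := ⊤

/-- The preference list which contains only the school `j`. -/
def Action.single {m : ℕ} (j : Fin m) : Action m 1 :=
  ⟨[j], List.nodup_singleton j, le_of_eq List.length_singleton⟩

/-- The data of the `m` schools: capacities `c_j`, bounded measurable value functions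
`v_j : T → ℝ₊` and measurable scoring functions `s_j : T → [0,1]`. -/
structure Market (d m : ℕ) where
  capacity : Fin m → ℕ
  value : Fin m → TypeSpace d → ℝ
  score : Fin m → TypeSpace d → unitInterval
  value_nonneg : ∀ j t, 0 ≤ value j t
  value_bounded : ∀ j, ∃ M : ℝ, ∀ t, value j t ≤ M
  value_measurable : ∀ j, Measurable (value j)
  score_measurable : ∀ j, Measurable (score j)

namespace Market

variable {d m : ℕ} (G : Market d m)

section Matching

variable {n ℓ : ℕ} (ta : Fin n → TypeSpace d × Action m ℓ)

/-- A tie-breaking choice: one linear order of the students (a permutation) for each school. -/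
abbrev TieBreak (n m : ℕ) : Type := Fin m → Equiv.Perm (Fin n)

/-- School `j` ranks student `i'` strictly above student `i`: higher score, ties being broken
by the permutation `τ j`. -/
def Ranks (τ : TieBreak n m) (j : Fin m) (i' i : Fin n) : Prop :=
  G.score j (ta i).1 < G.score j (ta i').1 ∨
    (G.score j (ta i).1 = G.score j (ta i').1 ∧ τ j i' < τ j i)

/-- The school to which student `i` proposes once `r i` schools of her list have rejected her
(`none` if her list is exhausted). -/
def proposal (r : Fin n → ℕ) (i : Fin n) : Option (Fin m) := (ta i).2.1[r i]?

open Classical in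
/-- One round of student-proposing deferred acceptance. The state `r` counts the rejections
received by each student. Each school `j` tentatively keeps the `c_j` best of its current
proposers and rejects the others. -/
noncomputable def daRound (τ : TieBreak n m) (r : Fin n → ℕ) : Fin n → ℕ := fun i =>
  match proposal ta r i with
  | none => r i
  | some j =>
      if (Finset.univ.filter
          (fun i' => proposal ta r i' = some j ∧ G.Ranks ta τ j i' i)).card < G.capacity j
      then r i else r i + 1

/-- The student-proposing deferred acceptance algorithm. Every round which changes the state adds
a rejection, and there are at most `∑ i, length (a_i)` rejections, so after that number of rounds
the state is final. The result is the school assigned to each student. -/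
noncomputable def deferredAcceptance (τ : TieBreak n m) : Fin n → Option (Fin m) :=
  proposal ta ((G.daRound ta τ)^[∑ i, (ta i).2.1.length] (fun _ => 0))

/-- Utility of a student of type `t` with a given assignment. -/
def assignedValue (t : TypeSpace d) : Option (Fin m) → ℝ
  | none => 0
  | some j => G.value j t

/-- The vector of utilities of the matching game, averaged over all tie-breaking choices. -/
noncomputable def utility (i : Fin n) : ℝ :=
  (∑ τ : TieBreak n m, G.assignedValue (ta i).1 (G.deferredAcceptance ta τ i)) /
    (Fintype.card (TieBreak n m) : ℝ)

end Matching

section InducedNormalForm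

variable {n ℓ : ℕ}

/-- The event that all types are distinct. -/
def distinctTypes (d m n ℓ : ℕ) : Set (Fin n → TypeSpace d × Action m ℓ) :=
  {ta | Function.Injective fun i => (ta i).1}

/-- The payoff `Ũ` of student `i` for a profile of distributional strategies: the expected utility
when the pairs (type, action) are drawn independently, conditionally on all types being distinct
(that is, types are drawn without replacement). -/
noncomputable def payoff (p : Fin n → Measure (TypeSpace d × Action m ℓ)) (i : Fin n) : ℝ :=
  (∫ ta, (distinctTypes d m n ℓ).indicator (fun ta => G.utility ta i) ta ∂(Measure.pi p)) /
    (∫ ta, (distinctTypes d m n ℓ).indicator (fun _ => (1 : ℝ)) ta ∂(Measure.pi p))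

/-- Distributional strategies: probability distributions on `T × A` whose marginal on `T`
is `μ`. -/
def strategies (m ℓ : ℕ) (μ : Measure (TypeSpace d)) : Set (Measure (TypeSpace d × Action m ℓ)) :=
  {p | IsProbabilityMeasure p ∧ p.map Prod.fst = μ}

/-- `p` is a pure Nash equilibrium of the induced normal form game `⟨n, S̃_μ, Ũ⟩`. -/
def IsEquilibrium (μ : Measure (TypeSpace d))
    (p : Fin n → Measure (TypeSpace d × Action m ℓ)) : Prop :=
  (∀ i, p i ∈ strategies m ℓ μ) ∧
    ∀ i, ∀ p' ∈ strategies m ℓ μ, G.payoff (Function.update p i p') i ≤ G.payoff p i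

/-- `p` is a symmetric equilibrium of the game `⟨n, S̃_μ, Ũ⟩`: it is a strategy, and it is an
equilibrium that all `n` students play `p`. -/
def IsSymmetricEquilibrium (n : ℕ) (μ : Measure (TypeSpace d))
    (p : Measure (TypeSpace d × Action m ℓ)) : Prop :=
  p ∈ strategies m ℓ μ ∧ G.IsEquilibrium μ (fun _ : Fin n => p)

end InducedNormalForm

/-- Strong α-reducibility: for every nonempty finite set `S` of types and every `q ∈ [0,1]^m`,
there is a fixed type-school pair `(t, j)`. -/
def StronglyAlphaReducible : Prop :=
  ∀ S : Set (TypeSpace d), S.Finite → S.Nonempty →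
    ∀ q : Fin m → ℝ, (∀ j, q j ∈ Set.Icc (0 : ℝ) 1) →
      ∃ t ∈ S, ∃ j : Fin m,
        (∀ t' ∈ S, G.score j t' ≤ G.score j t) ∧
        ∀ j' : Fin m, q j' * G.value j' t ≤ q j * G.value j t

section Greedy

/-- The binomial coefficient `x.choose (a - i)`, with value `0` when `a < i`. -/
def chooseSub (x a i : ℕ) : ℕ := if i ≤ a then x.choose (a - i) else 0

/-- `Proba(x, c) = ∑_{i=0}^{c-1} C(x,i) C(k-1-x,n-1-i) / C(k-1,n-1)` (hypergeometric). -/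
noncomputable def proba (k n x c : ℕ) : ℝ :=
  ∑ i ∈ Finset.range c,
    ((x.choose i : ℝ) * (chooseSub (k - 1 - x) (n - 1) i : ℝ)) / ((k - 1).choose (n - 1) : ℝ)

/-- State of the algorithm: `school i` is the school assigned to the `i`-th type (`none` if it is
unassigned), `count j` is the number `x_j` of types assigned to school `j`. -/
structure GreedyState (k m : ℕ) where
  school : Fin k → Option (Fin m)
  count : Fin m → ℕ

/-- Initially, all types are unassigned. -/
def greedyInit (k m : ℕ) : GreedyState k m := ⟨fun _ => none, fun _ => 0⟩

variable {k : ℕ} (n : ℕ) (t : Fin k → TypeSpace d)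

open Classical in
/-- An unassigned type which maximizes `s_j(t_i)` (`none` if there is no unassigned type). -/
noncomputable def topUnassigned (st : GreedyState k m) (j : Fin m) : Option (Fin k) :=
  ((List.finRange k).filter (fun i => st.school i = none)).argmax (fun i => G.score j (t i))

open Classical in
/-- The body of the inner loop of the algorithm, for school `j`. -/
noncomputable def greedyBody (st : GreedyState k m) (j : Fin m) : GreedyState k m :=
  match G.topUnassigned t st j with
  | none => st
  | some i =>
      if ∀ j' : Fin m,
          G.value j' (t i) * proba k n (st.count j') (G.capacity j') ≤
            G.value j (t i) * proba k n (st.count j) (G.capacity j)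
      then ⟨Function.update st.school i (some j), Function.update st.count j (st.count j + 1)⟩
      else st

/-- The inner loop of the algorithm, over all schools. -/
noncomputable def greedyFor (st : GreedyState k m) : GreedyState k m :=
  (List.finRange m).foldl (G.greedyBody n t) st

/-- `GreedyWhile st st'`: started in the state `st`, the loop "while some types are unassigned"
terminates, in the state `st'`. -/
inductive GreedyWhile : GreedyState k m → GreedyState k m → Prop
  | done (st : GreedyState k m) (h : ∀ i, st.school i ≠ none) : GreedyWhile st st
  | loop (st st' : GreedyState k m) (h : ∃ i, st.school i = none)
      (hs : GreedyWhile (G.greedyFor n t st) st') : GreedyWhile st st'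

/-- The uniform distribution over a finite collection. -/
noncomputable def uniformMeasure {α : Type*} [MeasurableSpace α] (f : Fin k → α) : Measure α :=
  (k : ENNReal)⁻¹ • ∑ i, Measure.dirac (f i)

/-- The algorithm, run on the types `(t_i)`, terminates and returns the distributional strategy
`p = Uniform {(t_i, a_i)}`, where `a_i` is the school assigned to type `i`. -/
def GreedyReturns (p : Measure (TypeSpace d × Action m 1)) : Prop :=
  ∃ (st : GreedyState k m) (a : Fin k → Fin m),
    G.GreedyWhile n t (greedyInit k m) st ∧ (∀ i, st.school i = some (a i)) ∧
      p = uniformMeasure fun i => (t i, Action.single (a i))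

end Greedy

end Market

end SchoolChoice

/-! With one-school lists and no ties, an applicant to `j` obtains `v_j` exactly when fewer than
`c_j` applicants to `j` outscore her (`utility_of_singleton`). Conditioning on distinct types means
that a player of type `x` faces a uniformly random `(n-1)`-subset of the other `k-1` types. If the
opponents follow `a`, applying to `j` is therefore worth `v_j(x) * Proba(b_j, c_j)`, where `b_j`
counts the types assigned to `j` that `j` ranks above `x` (`exists_card_filter_lt_eq_mul_proba`).

The greedy test compares these values with the current counts `x_j`. Types reach each school in
decreasing score order, ahead of all unassigned types, so when `x` is assigned every type counted in
`x_j` outscores it at `j`. At its own school `x` was the best unassigned type, so later arrivals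
rank below it and its own value is final. At other schools later arrivals may still outscore it,
which can only lower the value of a deviation. Hence the choice stays optimal; `GreedyInvariant`
records this argument.

The loop progresses by strong α-reducibility, applied to the unassigned types with `q_j = Proba(x_j,
c_j)`: it yields a pair passing the test (`card_unassigned_greedyFor_lt`).

Finally, the payoff is a ratio whose denominator depends only on the type marginals, and whose
numerator averages the pure-action payoffs of each type (`integral_indicator_distinctTypes`).
Optimality type by type thus excludes every distributional deviation. -/

namespace SchoolChoice

open MeasureTheory

/-! ### Hypergeometric counting for draws without replacement -/

section Counting

/-- Two finite sets of the same size that avoid a point are exchanged by a permutation fixing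
that point. -/
theorem exists_perm_image_eq {α : Type*} [Fintype α] [DecidableEq α] {x : α} {S S' : Finset α}
    (hx : x ∉ S) (hx' : x ∉ S') (h : S.card = S'.card) :
    ∃ π : Equiv.Perm α, π x = x ∧ S.image π = S' := by
  let e : {y // y ∈ S} ≃ {y // y ∈ S'} := Finset.equivOfCardEq h
  let π₁ : Equiv.Perm α := e.extendSubtype
  have hz : π₁ x ∉ S' := e.extendSubtype_not_mem x hx
  -- `π₁` may move `x`. As neither `π₁ x` nor `x` lies in `S'`, a swap repairs this without
  -- disturbing the image of `S`.
  refine ⟨π₁.trans (Equiv.swap (π₁ x) x), by simp, ?_⟩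
  refine Finset.eq_of_subset_of_card_le ?_ ?_
  · intro y hy
    obtain ⟨u, hu, rfl⟩ := Finset.mem_image.1 hy
    have hu' : π₁ u ∈ S' := e.extendSubtype_mem u hu
    have h1 : π₁ u ≠ π₁ x := fun h => hz (h ▸ hu')
    have h2 : π₁ u ≠ x := fun h => hx' (h ▸ hu')
    rw [Equiv.trans_apply, Equiv.swap_apply_of_ne_of_ne h1 h2]
    exact hu'
  · rw [Finset.card_image_of_injective _ (Equiv.injective _), h]

/-- The injective maps `Fin n → Fin k` which send `i` to `x`. -/
def pointedInj {n k : ℕ} (i : Fin n) (x : Fin k) : Finset (Fin n → Fin k) :=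
  Finset.univ.filter fun σ => Function.Injective σ ∧ σ i = x

/-- By symmetry, composing with a permutation that fixes `x` and carries `S` to `S'` injects one
fibre into the other. Used in both directions, it makes the random opponent set uniform. -/
theorem card_fiber_le {n k : ℕ} (i : Fin n) {x : Fin k} {S S' : Finset (Fin k)}
    (hx : x ∉ S) (hx' : x ∉ S') (h : S.card = S'.card) :
    ((pointedInj i x).filter fun σ => (Finset.univ.image σ).erase x = S).card ≤
      ((pointedInj i x).filter fun σ => (Finset.univ.image σ).erase x = S').card := by
  obtain ⟨π, hπx, hπ⟩ := exists_perm_image_eq hx hx' h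
  refine Finset.card_le_card_of_injOn (fun σ => π ∘ σ) ?_ ?_
  · intro σ hσ
    simp only [pointedInj, Finset.coe_filter, Finset.mem_filter, Finset.mem_univ, true_and,
      Set.mem_ofPred_eq] at hσ ⊢
    obtain ⟨⟨h1, h2⟩, h3⟩ := hσ
    refine ⟨⟨π.injective.comp h1, by simp [h2, hπx]⟩, ?_⟩
    rw [← Finset.image_image, ← hπ, ← h3, Finset.image_erase π.injective, hπx]
  · intro σ _ σ' _ hh
    exact (π.injective.comp_left) hh

theorem card_filter_mem_eq {n k : ℕ} {x : Fin k} {B : Finset (Fin k)} (hx : x ∉ B)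
    {σ : Fin n → Fin k} (hσ : Function.Injective σ) :
    (Finset.univ.filter fun i' => σ i' ∈ B).card =
      ((Finset.univ.image σ).erase x ∩ B).card := by
  rw [← Finset.card_image_of_injective _ hσ]
  congr 1
  ext y
  simp only [Finset.mem_image, Finset.mem_filter, Finset.mem_univ, true_and, Finset.mem_inter,
    Finset.mem_erase]
  constructor
  · rintro ⟨a, ha, rfl⟩
    exact ⟨⟨fun h => hx (h ▸ ha), a, rfl⟩, ha⟩
  · rintro ⟨⟨_, a, rfl⟩, ha⟩
    exact ⟨a, ha, rfl⟩

/-- The number of `N`-subsets of `U` that meet `B ⊆ U` in exactly `r` points. -/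
theorem card_powersetCard_inter_eq {α : Type*} [DecidableEq α] {U B : Finset α} (hB : B ⊆ U)
    (N r : ℕ) :
    ((U.powersetCard N).filter fun S => (S ∩ B).card = r).card =
      B.card.choose r * Market.chooseSub (U.card - B.card) N r := by
  unfold Market.chooseSub
  split_ifs with hr
  · rw [← Finset.card_sdiff_of_subset hB, ← Finset.card_powersetCard, ← Finset.card_powersetCard,
      ← Finset.card_product]
    refine Finset.card_bij' (fun S _ => (S ∩ B, S \ B)) (fun P _ => P.1 ∪ P.2) ?_ ?_ ?_ ?_
    · intro S hS
      simp only [Finset.mem_filter, Finset.mem_powersetCard, Finset.mem_product] at hS ⊢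
      obtain ⟨⟨h1, h2⟩, h3⟩ := hS
      refine ⟨⟨Finset.inter_subset_right, h3⟩, Finset.sdiff_subset_sdiff h1 subset_rfl, ?_⟩
      have := Finset.card_inter_add_card_sdiff S B
      omega
    · rintro ⟨P, Q⟩ hP
      simp only [Finset.mem_filter, Finset.mem_powersetCard, Finset.mem_product] at hP ⊢
      obtain ⟨⟨h1, h2⟩, h3, h4⟩ := hP
      have hd : Disjoint Q B := (Finset.disjoint_sdiff.mono_right h3).symm
      refine ⟨⟨Finset.union_subset (h1.trans hB) (h3.trans Finset.sdiff_subset), ?_⟩, ?_⟩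
      · rw [Finset.card_union_of_disjoint (hd.mono_right h1).symm]
        omega
      · rw [Finset.union_inter_distrib_right, Finset.inter_eq_left.2 h1,
          Finset.disjoint_iff_inter_eq_empty.1 hd, Finset.union_empty, h2]
    · intro S _
      exact (Finset.union_comm _ _).trans (Finset.sdiff_union_inter S B)
    · rintro ⟨P, Q⟩ hP
      simp only [Finset.mem_powersetCard, Finset.mem_product] at hP
      obtain ⟨⟨h1, h2⟩, h3, h4⟩ := hP
      have hd : Disjoint Q B := (Finset.disjoint_sdiff.mono_right h3).symm
      refine Prod.ext (Finset.ext fun y => ?_) (Finset.ext fun y => ?_)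
      · have : y ∈ P → y ∈ B := fun h => h1 h
        have : y ∈ Q → y ∉ B := fun h => Finset.disjoint_left.1 hd h
        simp only [Finset.mem_inter, Finset.mem_union]
        tauto
      · have : y ∈ P → y ∈ B := fun h => h1 h
        have : y ∈ Q → y ∉ B := fun h => Finset.disjoint_left.1 hd h
        simp only [Finset.mem_sdiff, Finset.mem_union]
        tauto
  · rw [mul_zero, Finset.card_eq_zero, Finset.filter_eq_empty_iff]
    intro S hS h
    have := Finset.card_le_card (Finset.inter_subset_left (s₁ := S) (s₂ := B))
    rw [(Finset.mem_powersetCard.1 hS).2] at this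
    omega

/-- The number of `N`-subsets of `U` that meet `B ⊆ U` in fewer than `c` points. -/
theorem card_powersetCard_inter_lt {α : Type*} [DecidableEq α] {U B : Finset α} (hB : B ⊆ U)
    (N c : ℕ) :
    ((U.powersetCard N).filter fun S => (S ∩ B).card < c).card =
      ∑ r ∈ Finset.range c, B.card.choose r * Market.chooseSub (U.card - B.card) N r := by
  rw [Finset.card_eq_sum_card_fiberwise (f := fun S => (S ∩ B).card) (t := Finset.range c)]
  · refine Finset.sum_congr rfl fun r hr => ?_
    rw [← card_powersetCard_inter_eq hB, Finset.filter_filter]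
    congr 1
    refine Finset.filter_congr fun S _ => ?_
    have := Finset.mem_range.1 hr
    omega
  · intro S hS
    simpa using (Finset.mem_filter.1 hS).2

/-- This is the probabilistic meaning of `proba`: a uniform `(n-1)`-subset of the types other than
`x` meets `B` in fewer than `c` points. -/
theorem proba_eq_card_div {n k : ℕ} {x : Fin k} {B : Finset (Fin k)} (hx : x ∉ B) (c : ℕ) :
    Market.proba k n B.card c =
      ((((Finset.univ.erase x).powersetCard (n - 1)).filter fun S => (S ∩ B).card < c).card : ℝ) /
        ((k - 1).choose (n - 1) : ℝ) := by
  have hB : B ⊆ Finset.univ.erase x := fun y hy =>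
    Finset.mem_erase.2 ⟨fun h => hx (h ▸ hy), Finset.mem_univ y⟩
  rw [card_powersetCard_inter_lt hB, Market.proba, ← Finset.sum_div]
  simp

theorem proba_mem_Icc {n k : ℕ} {x : Fin k} {B : Finset (Fin k)} (hx : x ∉ B) (c : ℕ) :
    Market.proba k n B.card c ∈ Set.Icc (0 : ℝ) 1 := by
  rw [proba_eq_card_div hx]
  refine ⟨by positivity, div_le_one_of_le₀ ?_ (by positivity)⟩
  have h := Finset.card_filter_le ((Finset.univ.erase x).powersetCard (n - 1))
    (fun S => (S ∩ B).card < c)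
  rw [Finset.card_powersetCard, Finset.card_erase_of_mem (Finset.mem_univ x), Finset.card_univ,
    Fintype.card_fin] at h
  exact_mod_cast h

/-- When the `n - 1` opponents of `i` are drawn without replacement among the `k - 1` types other
than `x`, the event that fewer than `c` of them fall in `B` has weight proportional to
`proba k n (card B) c`. -/
theorem exists_card_filter_lt_eq_mul_proba {n k : ℕ} (hnk : n ≤ k) (i : Fin n) (x : Fin k) :
    ∃ K : ℝ, 0 ≤ K ∧ ∀ (B : Finset (Fin k)) (c : ℕ), x ∉ B →
      (((pointedInj i x).filter fun σ =>
        (Finset.univ.filter fun i' => σ i' ∈ B).card < c).card : ℝ) =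
          K * Market.proba k n B.card c := by
  have hpos : (0 : ℝ) < ((k - 1).choose (n - 1) : ℝ) := by
    exact_mod_cast Nat.choose_pos (by omega)
  obtain ⟨S₀, hS₀⟩ : ((Finset.univ.erase x).powersetCard (n - 1)).Nonempty := by
    rw [Finset.powersetCard_nonempty, Finset.card_erase_of_mem (Finset.mem_univ x),
      Finset.card_univ, Fintype.card_fin]
    omega
  -- `κ` is the common fibre size, computed at an arbitrary `S₀`; the binomial factor in `K` cancels
  -- the normalization of `proba`.
  set κ := ((pointedInj i x).filter fun σ => (Finset.univ.image σ).erase x = S₀).card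
  refine ⟨κ * ((k - 1).choose (n - 1) : ℝ), by positivity, fun B c hx => ?_⟩
  rw [proba_eq_card_div hx, mul_assoc, mul_div_cancel₀ _ hpos.ne']
  norm_cast
  rw [Finset.card_eq_sum_card_fiberwise (f := fun σ => (Finset.univ.image σ).erase x)
    (t := ((Finset.univ.erase x).powersetCard (n - 1)).filter fun S => (S ∩ B).card < c),
    mul_comm, ← smul_eq_mul, ← Finset.sum_const]
  · refine Finset.sum_congr rfl fun S hS => ?_
    obtain ⟨hS1, hS2⟩ := Finset.mem_filter.1 hS
    have key : ∀ S ∈ (Finset.univ.erase x).powersetCard (n - 1), x ∉ S := fun S hS h =>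
      Finset.notMem_erase x _ ((Finset.mem_powersetCard.1 hS).1 h)
    have hc : S.card = S₀.card := by
      rw [(Finset.mem_powersetCard.1 hS1).2, (Finset.mem_powersetCard.1 hS₀).2]
    rw [show κ = _ from le_antisymm (card_fiber_le i (key S₀ hS₀) (key S hS1) hc.symm)
      (card_fiber_le i (key S hS1) (key S₀ hS₀) hc), Finset.filter_filter]
    congr 1
    refine Finset.filter_congr fun σ hσ => and_iff_right_of_imp ?_
    rintro rfl
    rw [card_filter_mem_eq hx (Finset.mem_filter.1 hσ).2.1]
    exact hS2
  · intro σ hσ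
    simp only [pointedInj, Finset.coe_filter, Finset.mem_filter, Finset.mem_univ, true_and,
      Set.mem_ofPred_eq, Finset.mem_powersetCard] at hσ ⊢
    obtain ⟨⟨h1, h2⟩, h3⟩ := hσ
    refine ⟨⟨Finset.erase_subset_erase _ (Finset.subset_univ _), ?_⟩, ?_⟩
    · rw [Finset.card_erase_of_mem, Finset.card_image_of_injective _ h1, Finset.card_univ,
        Fintype.card_fin]
      exact Finset.mem_image.2 ⟨i, Finset.mem_univ i, h2⟩
    · rwa [← card_filter_mem_eq hx h1]

end Counting

namespace Market

variable {d m : ℕ} (G : Market d m)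

/-! ### Deferred acceptance with lists of at most one school -/

section SingleSchoolLists

variable {n : ℕ} {ta : Fin n → TypeSpace d × Action m 1}

theorem proposal_eq_some_iff (r : Fin n → ℕ) (i : Fin n) (j : Fin m) :
    proposal ta r i = some j ↔ (ta i).2.1 = [j] ∧ r i = 0 := by
  have h := (ta i).2.2.2
  unfold proposal
  rcases hl : (ta i).2.1 with _ | ⟨b, _ | ⟨b', l⟩⟩
  · simp
  · cases r i <;> simp
  · simp [hl] at h

/-- With lists of length at most one, deferred acceptance is stationary after one round. -/
theorem daRound_daRound_zero (τ : TieBreak n m) :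
    G.daRound ta τ (G.daRound ta τ fun _ => 0) = G.daRound ta τ fun _ => 0 := by
  classical
  set r := G.daRound ta τ fun _ => 0 with hr
  funext i
  rcases hp : proposal ta r i with _ | j
  · simp [daRound, hp]
  · have hi := (proposal_eq_some_iff r i j).1 hp
    have hp0 : proposal ta (fun _ => 0) i = some j := (proposal_eq_some_iff _ i j).2 ⟨hi.1, rfl⟩
    have h0 : r i = 0 := hi.2
    have hlt : (Finset.univ.filter fun i' =>
        proposal ta (fun _ => 0) i' = some j ∧ G.Ranks ta τ j i' i).card < G.capacity j := by
      by_contra hcon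
      rw [hr] at h0
      simp only [daRound, hp0] at h0
      rw [if_neg hcon] at h0
      omega
    -- Second-round proposers to `j` already proposed to it in the first round, so the competition
    -- has only shrunk.
    have hle : (Finset.univ.filter fun i' =>
        proposal ta r i' = some j ∧ G.Ranks ta τ j i' i).card < G.capacity j := by
      refine lt_of_le_of_lt (Finset.card_le_card ?_) hlt
      refine Finset.monotone_filter_right _ fun i' _ h => ⟨?_, h.2⟩
      exact (proposal_eq_some_iff _ i' j).2 ⟨((proposal_eq_some_iff r i' j).1 h.1).1, rfl⟩
    simp only [daRound, hp]
    exact if_pos hle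

theorem deferredAcceptance_of_nil (τ : TieBreak n m) {i : Fin n} (hi : (ta i).2.1 = []) :
    G.deferredAcceptance ta τ i = none := by
  simp [deferredAcceptance, proposal, hi]

open Classical in
theorem deferredAcceptance_of_singleton (τ : TieBreak n m) {i : Fin n} {j : Fin m}
    (hi : (ta i).2.1 = [j]) :
    G.deferredAcceptance ta τ i =
      if (Finset.univ.filter fun i' => (ta i').2.1 = [j] ∧ G.Ranks ta τ j i' i).card < G.capacity j
      then some j else none := by
  -- The list of `i` has length one, so at least one round is run; all further rounds change
  -- nothing.
  obtain ⟨N, hN⟩ : ∃ N, ∑ i, (ta i).2.1.length = N + 1 := by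
    refine Nat.exists_eq_succ_of_ne_zero (ne_of_gt ?_)
    refine lt_of_lt_of_le ?_ (Finset.single_le_sum (fun i _ => Nat.zero_le _) (Finset.mem_univ i))
    simp [hi]
  have hp0 : proposal ta (fun _ => 0) i = some j := (proposal_eq_some_iff _ i j).2 ⟨hi, rfl⟩
  rw [deferredAcceptance, hN, Function.iterate_succ_apply,
    Function.iterate_fixed (G.daRound_daRound_zero τ)]
  have hr : G.daRound ta τ (fun _ => 0) i =
      if (Finset.univ.filter fun i' => (ta i').2.1 = [j] ∧ G.Ranks ta τ j i' i).card < G.capacity j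
      then 0 else 1 := by
    simp only [daRound, hp0]
    simp only [proposal_eq_some_iff, and_true, zero_add]
  split_ifs at hr ⊢
  · exact (proposal_eq_some_iff _ i j).2 ⟨hi, hr⟩
  · simp [proposal, hi, hr]

theorem utility_of_nil {i : Fin n} (hi : (ta i).2.1 = []) : G.utility ta i = 0 := by
  simp [utility, G.deferredAcceptance_of_nil _ hi, assignedValue]

/-- If a school ranks the students without ties, a student who applies to it only obtains its
value exactly when fewer than `c_j` better students apply to it. -/
theorem utility_of_singleton {i : Fin n} {j : Fin m} (hi : (ta i).2.1 = [j])
    (hinj : Function.Injective fun i => G.score j (ta i).1) :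
    G.utility ta i =
      if (Finset.univ.filter fun i' =>
        (ta i').2.1 = [j] ∧ G.score j (ta i).1 < G.score j (ta i').1).card < G.capacity j
      then G.value j (ta i).1 else 0 := by
  classical
  have hR : ∀ (τ : TieBreak n m) i', G.Ranks ta τ j i' i ↔
      G.score j (ta i).1 < G.score j (ta i').1 := by
    intro τ i'
    refine or_iff_left ?_
    rintro ⟨h, h'⟩
    rw [hinj h] at h'
    exact lt_irrefl _ h'
  have hc : (Fintype.card (TieBreak n m) : ℝ) ≠ 0 := by
    exact_mod_cast Fintype.card_ne_zero
  unfold utility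
  simp only [G.deferredAcceptance_of_singleton _ hi, hR]
  rw [Finset.sum_const, Finset.card_univ, nsmul_eq_mul, mul_div_cancel_left₀ _ hc]
  split_ifs <;> rfl

end SingleSchoolLists

/-! ### Invariant and termination of the greedy algorithm -/

section Greedy

variable {k : ℕ} (n : ℕ) (t : Fin k → TypeSpace d)

/-- The types assigned to school `j`. -/
def GreedyState.assigned (st : GreedyState k m) (j : Fin m) : Finset (Fin k) :=
  Finset.univ.filter fun y => st.school y = some j

/-- The unassigned types. -/
def GreedyState.unassigned (st : GreedyState k m) : Finset (Fin k) :=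
  Finset.univ.filter fun y => st.school y = none

/-- The types assigned to school `j` which it ranks above type `i`. -/
noncomputable def assignedAbove (st : GreedyState k m) (i : Fin k) (j : Fin m) : Finset (Fin k) :=
  Finset.univ.filter fun y => st.school y = some j ∧ G.score j (t i) < G.score j (t y)

/-- The invariant of the greedy algorithm. -/
structure GreedyInvariant (st : GreedyState k m) : Prop where
  count_eq : ∀ j, st.count j = (st.assigned j).card
  score_lt : ∀ i y j, st.school i = none → st.school y = some j →
    G.score j (t i) < G.score j (t y)
  -- `B` is a snapshot of the assigned sets when `i` was assigned. It remains exact at the school of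
  -- `i` and is only a lower bound elsewhere.
  exists_witness : ∀ i j, st.school i = some j → ∃ B : Fin m → Finset (Fin k),
    (∀ j', B j' ⊆ G.assignedAbove t st i j') ∧ B j = G.assignedAbove t st i j ∧
      ∀ j', G.value j' (t i) * proba k n (B j').card (G.capacity j') ≤
        G.value j (t i) * proba k n (B j).card (G.capacity j)

theorem greedyInvariant_init : G.GreedyInvariant n t (greedyInit k m) where
  count_eq j := by simp [greedyInit, GreedyState.assigned]
  score_lt i y j _ h := by simp [greedyInit] at h
  exists_witness i j h := by simp [greedyInit] at h

theorem topUnassigned_spec {st : GreedyState k m} {j : Fin m} {i : Fin k}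
    (h : G.topUnassigned t st j = some i) :
    st.school i = none ∧ ∀ y, st.school y = none → G.score j (t y) ≤ G.score j (t i) := by
  classical
  refine ⟨?_, fun y hy => ?_⟩
  · simpa using List.argmax_mem (Option.mem_def.2 h)
  · exact List.le_of_mem_argmax (f := fun i => G.score j (t i))
      (by simpa using hy) (Option.mem_def.2 h)

theorem exists_topUnassigned {st : GreedyState k m} (j : Fin m) (h : ∃ i, st.school i = none) :
    ∃ i, G.topUnassigned t st j = some i := by
  classical
  obtain ⟨y, hy⟩ := h
  refine Option.ne_none_iff_exists'.1 fun h => ?_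
  have := List.argmax_eq_none.1 h
  simp only [List.filter_eq_nil_iff, List.mem_finRange, true_imp_iff] at this
  exact this y (by simpa using hy)

open Classical in
theorem greedyBody_eq {st : GreedyState k m} {j : Fin m} {i : Fin k}
    (h : G.topUnassigned t st j = some i) :
    G.greedyBody n t st j =
      if ∀ j' : Fin m,
          G.value j' (t i) * proba k n (st.count j') (G.capacity j') ≤
            G.value j (t i) * proba k n (st.count j) (G.capacity j)
      then ⟨Function.update st.school i (some j), Function.update st.count j (st.count j + 1)⟩
      else st := by
  simp only [greedyBody, h]

variable {n t}

theorem GreedyInvariant.greedyBody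
    (hdistinct : ∀ j : Fin m, Function.Injective fun i => G.score j (t i))
    {st : GreedyState k m} (hst : G.GreedyInvariant n t st) (j : Fin m) :
    G.GreedyInvariant n t (G.greedyBody n t st j) := by
  rcases htop : G.topUnassigned t st j with _ | i
  · simpa only [Market.greedyBody, htop] using hst
  rw [G.greedyBody_eq n t htop]
  split_ifs with hv
  swap
  · exact hst
  obtain ⟨hi, hmax⟩ := G.topUnassigned_spec t htop
  have hmax' : ∀ y, y ≠ i → st.school y = none → G.score j (t y) < G.score j (t i) :=
    fun y hy h => lt_of_le_of_ne (hmax y h) fun he => hy (hdistinct j he)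
  have hne : ∀ {y j'}, st.school y = some j' → y ≠ i := by
    rintro y j' h rfl
    rw [hi] at h
    exact absurd h (by simp)
  refine ⟨fun b => ?_, fun y z b hy hz => ?_, fun y b hy => ?_⟩
  · rcases eq_or_ne b j with rfl | hb
    · have : (GreedyState.assigned ⟨Function.update st.school i (some b),
          Function.update st.count b (st.count b + 1)⟩ b) = insert i (st.assigned b) := by
        ext y
        rcases eq_or_ne y i with rfl | hy <;> simp [GreedyState.assigned, *]
      rw [this, Finset.card_insert_of_notMem (by simp [GreedyState.assigned, hi]), ← hst.count_eq]
      simp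
    · have : (GreedyState.assigned ⟨Function.update st.school i (some j),
          Function.update st.count j (st.count j + 1)⟩ b) = st.assigned b := by
        ext y
        rcases eq_or_ne y i with rfl | hy <;> simp [GreedyState.assigned, hb.symm, *]
      rw [this, ← hst.count_eq]
      simp [hb]
  · rcases eq_or_ne y i with rfl | hyi
    · simp at hy
    simp only [Function.update_of_ne hyi] at hy
    rcases eq_or_ne z i with rfl | hzi
    · simp only [Function.update_self, Option.some.injEq] at hz
      subst hz
      exact hmax' y hyi hy
    · simp only [Function.update_of_ne hzi] at hz
      exact hst.score_lt y z b hy hz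
  · have hsub : ∀ y b, G.assignedAbove t st y b ⊆ G.assignedAbove t
        ⟨Function.update st.school i (some j), Function.update st.count j (st.count j + 1)⟩ y b := by
      intro y b z hz
      simp only [assignedAbove, Finset.mem_filter, Finset.mem_univ, true_and] at hz ⊢
      rwa [Function.update_of_ne (hne hz.1)]
    have heq : ∀ y b, (b = j → G.score j (t i) ≤ G.score j (t y)) →
        G.assignedAbove t st y b = G.assignedAbove t
          ⟨Function.update st.school i (some j),
            Function.update st.count j (st.count j + 1)⟩ y b := by
      intro y b hb
      refine (hsub y b).antisymm fun z hz => ?_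
      simp only [assignedAbove, Finset.mem_filter, Finset.mem_univ, true_and] at hz ⊢
      rcases eq_or_ne z i with rfl | hzi
      · simp only [Function.update_self, Option.some.injEq] at hz
        obtain ⟨rfl, h⟩ := hz
        exact absurd h (hb rfl).not_gt
      · rwa [Function.update_of_ne hzi] at hz
    rcases eq_or_ne y i with rfl | hyi
    · simp only [Function.update_self, Option.some.injEq] at hy
      subst hy
      have habove : ∀ b, st.assigned b = G.assignedAbove t st y b := by
        intro b
        ext z
        simp only [GreedyState.assigned, assignedAbove, Finset.mem_filter, Finset.mem_univ,
          true_and]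
        exact (and_iff_left_of_imp fun h => hst.score_lt y z b hi h).symm
      -- For the newly assigned type the snapshot is the current assignment: by `score_lt`, all
      -- types already placed outscore it at their schools.
      refine ⟨st.assigned, fun b => habove b ▸ hsub y b, ?_, fun b => ?_⟩
      · rw [habove, heq y j fun _ => le_rfl]
      · rw [← hst.count_eq, ← hst.count_eq]
        exact hv b
    · simp only [Function.update_of_ne hyi] at hy
      obtain ⟨B, h1, h2, h3⟩ := hst.exists_witness y b hy
      refine ⟨B, fun b' => (h1 b').trans (hsub y b'), h2.trans (heq y b ?_), h3⟩
      -- If the new type joins the school of `y`, it scores below `y` there, so the set above `y` is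
      -- unchanged.
      rintro rfl
      exact (hst.score_lt i y b hi hy).le

theorem GreedyInvariant.greedyFor
    (hdistinct : ∀ j : Fin m, Function.Injective fun i => G.score j (t i))
    {st : GreedyState k m} (hst : G.GreedyInvariant n t st) :
    G.GreedyInvariant n t (G.greedyFor n t st) :=
  List.foldlRecOn _ _ hst fun _ h j _ => h.greedyBody G hdistinct j

theorem GreedyInvariant.greedyWhile
    (hdistinct : ∀ j : Fin m, Function.Injective fun i => G.score j (t i))
    {st st' : GreedyState k m} (h : G.GreedyWhile n t st st') (hst : G.GreedyInvariant n t st) :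
    G.GreedyInvariant n t st' := by
  induction h with
  | done => exact hst
  | loop _ _ _ _ ih => exact ih (hst.greedyFor G hdistinct)

theorem greedyBody_eq_or_card_lt (st : GreedyState k m) (j : Fin m) :
    G.greedyBody n t st j = st ∨
      (G.greedyBody n t st j).unassigned.card < st.unassigned.card := by
  rcases htop : G.topUnassigned t st j with _ | i
  · left
    simp only [greedyBody, htop]
  rw [G.greedyBody_eq n t htop]
  split_ifs
  · right
    have hi := (G.topUnassigned_spec t htop).1
    refine Finset.card_lt_card ((Finset.ssubset_iff_of_subset fun y hy => ?_).2 ⟨i, ?_, ?_⟩)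
    · rcases eq_or_ne y i with rfl | hyi
      · simp [GreedyState.unassigned] at hy
      · simpa [GreedyState.unassigned, hyi] using hy
    · simpa [GreedyState.unassigned] using hi
    · simp [GreedyState.unassigned]
  · exact Or.inl rfl

/-- Counts change within a pass, but a pass without progress performs every test on the initial
state `st`. This is what allows reducibility to be applied to one fixed `q`. -/
theorem foldl_greedyBody_card (l : List (Fin m)) (st : GreedyState k m) :
    ((∀ j ∈ l, G.greedyBody n t st j = st) ∧ l.foldl (G.greedyBody n t) st = st) ∨
      (l.foldl (G.greedyBody n t) st).unassigned.card < st.unassigned.card := by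
  induction l generalizing st with
  | nil => exact Or.inl (by simp)
  | cons j l ih =>
    rw [List.foldl_cons]
    rcases G.greedyBody_eq_or_card_lt (n := n) (t := t) st j with h | h
    · rw [h]
      exact (ih st).imp_left fun h' => ⟨List.forall_mem_cons.2 ⟨h, h'.1⟩, h'.2⟩
    · refine Or.inr (lt_of_le_of_lt ?_ h)
      rcases ih (G.greedyBody n t st j) with h' | h'
      · rw [h'.2]
      · exact h'.le

theorem card_unassigned_greedyFor_lt (hred : G.StronglyAlphaReducible) {st : GreedyState k m}
    (hst : G.GreedyInvariant n t st) (h : ∃ i, st.school i = none)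
    (hdistinct : ∀ j : Fin m, Function.Injective fun i => G.score j (t i)) :
    (G.greedyFor n t st).unassigned.card < st.unassigned.card := by
  refine (G.foldl_greedyBody_card (List.finRange m) st).resolve_left fun ⟨hfix, _⟩ => ?_
  obtain ⟨i₀, hi₀⟩ := h
  obtain ⟨_, ⟨i, hi, rfl⟩, j, htop, hval⟩ := hred (t '' {i | st.school i = none})
    (Set.toFinite _) ⟨_, i₀, hi₀, rfl⟩ (fun j => proba k n (st.count j) (G.capacity j))
    fun j => by
      rw [hst.count_eq]
      exact proba_mem_Icc (x := i₀) (by simp [GreedyState.assigned, hi₀]) _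
  obtain ⟨y, hy⟩ := G.exists_topUnassigned t j ⟨i₀, hi₀⟩
  obtain ⟨hy0, hymax⟩ := G.topUnassigned_spec t hy
  -- Distinct scores identify the top type given by reducibility with the one the algorithm
  -- examines.
  obtain rfl : y = i := hdistinct j (le_antisymm (htop _ ⟨y, hy0, rfl⟩) (hymax i hi))
  have hj := hfix j (List.mem_finRange j)
  rw [G.greedyBody_eq n t hy, if_pos fun j' => by simpa only [mul_comm] using hval j'] at hj
  have := congrArg (fun st => st.school y) hj
  simp [hy0] at this

theorem exists_greedyWhile (hred : G.StronglyAlphaReducible)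
    (hdistinct : ∀ j : Fin m, Function.Injective fun i => G.score j (t i))
    (st : GreedyState k m) (hst : G.GreedyInvariant n t st) :
    ∃ st', G.GreedyWhile n t st st' ∧ ∀ i, st'.school i ≠ none := by
  induction hN : st.unassigned.card using Nat.strong_induction_on generalizing st with
  | _ N ih =>
    by_cases h : ∃ i, st.school i = none
    · obtain ⟨st', h1, h2⟩ := ih _ (hN ▸ G.card_unassigned_greedyFor_lt hred hst h hdistinct) _
        (hst.greedyFor G hdistinct) rfl
      exact ⟨st', .loop st st' h h1, h2⟩
    · rw [not_exists] at h
      exact ⟨st, .done st h, h⟩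

/-- The algorithm terminates. -/
theorem exists_greedyReturns (hred : G.StronglyAlphaReducible)
    (hdistinct : ∀ j : Fin m, Function.Injective fun i => G.score j (t i)) :
    ∃ p, G.GreedyReturns n t p := by
  obtain ⟨st, h1, h2⟩ := G.exists_greedyWhile hred hdistinct _ (G.greedyInvariant_init n t)
  choose a ha using fun i => Option.ne_none_iff_exists'.1 (h2 i)
  exact ⟨_, st, a, h1, ha, rfl⟩

/-- In the strategy returned by the algorithm, each type is compared with sets of opponents that
are smaller than those she would face by deviating. -/
theorem GreedyInvariant.exists_witness_of_school_eq {st : GreedyState k m}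
    (hst : G.GreedyInvariant n t st) {a : Fin k → Fin m} (ha : ∀ i, st.school i = some (a i))
    (x : Fin k) :
    ∃ B : Fin m → Finset (Fin k),
      (∀ j, B j ⊆ Finset.univ.filter fun y => a y = j ∧ G.score j (t x) < G.score j (t y)) ∧
      (B (a x) = Finset.univ.filter fun y => a y = a x ∧
        G.score (a x) (t x) < G.score (a x) (t y)) ∧
      ∀ j, G.value j (t x) * proba k n (B j).card (G.capacity j) ≤
        G.value (a x) (t x) * proba k n (B (a x)).card (G.capacity (a x)) := by
  simpa only [assignedAbove, ha, Option.some.injEq] using hst.exists_witness x (a x) (ha x)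

end Greedy

end Market

instance (m ℓ : ℕ) : DiscreteMeasurableSpace (Action m ℓ) := ⟨fun _ => trivial⟩

instance (m ℓ : ℕ) : Finite (Action m ℓ) :=
  Finite.of_injective (fun a : Action m ℓ => (⟨a.1, a.2.1⟩ : {l : List (Fin m) // l.Nodup}))
    fun _ _ h => Subtype.ext (Subtype.mk.inj h)

noncomputable instance (m ℓ : ℕ) : Fintype (Action m ℓ) := Fintype.ofFinite _

namespace Market

/-! ### Uniform measures on finite families -/

section UniformMeasure

variable {k : ℕ} {α β : Type*} [MeasurableSpace α] [MeasurableSpace β]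

theorem uniformMeasure_apply (f : Fin k → α) {s : Set α} (hs : MeasurableSet s) :
    uniformMeasure f s = (k : ENNReal)⁻¹ * ∑ i, s.indicator 1 (f i) := by
  simp [uniformMeasure, Measure.dirac_apply' _ hs]

theorem isProbabilityMeasure_uniformMeasure (hk : k ≠ 0) (f : Fin k → α) :
    IsProbabilityMeasure (uniformMeasure f) := by
  refine ⟨?_⟩
  rw [uniformMeasure_apply f MeasurableSet.univ]
  simp only [Set.indicator_univ, Pi.one_apply, Finset.sum_const, Finset.card_univ,
    Fintype.card_fin, nsmul_eq_mul, mul_one]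
  exact ENNReal.inv_mul_cancel (by exact_mod_cast hk) (ENNReal.natCast_ne_top k)

theorem map_uniformMeasure (f : Fin k → α) {g : α → β} (hg : Measurable g) :
    (uniformMeasure f).map g = uniformMeasure fun i => g (f i) := by
  ext s hs
  rw [Measure.map_apply hg hs, uniformMeasure_apply _ (hg hs), uniformMeasure_apply _ hs]
  rfl

open Classical in
theorem uniformMeasure_graph_real_singleton [MeasurableSingletonClass α] (a : Fin k → α)
    (y : Fin k × α) :
    (uniformMeasure fun i => (i, a i)).real {y} = if y.2 = a y.1 then (k : ℝ)⁻¹ else 0 := by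
  rw [measureReal_def, uniformMeasure_apply _ (measurableSet_singleton y),
    Finset.sum_eq_single y.1]
  · obtain ⟨x, b⟩ := y
    by_cases h : b = a x
    · subst h
      simp
    · have : (x, a x) ∉ ({(x, b)} : Set (Fin k × α)) := fun h' => h (congrArg Prod.snd h').symm
      simp [this, h]
  · intro i _ hi
    refine Set.indicator_of_notMem (fun h => hi ?_) _
    exact congrArg Prod.fst h
  · simp

end UniformMeasure

/-! ### Reduction of payoffs to finite sums over type indices -/

section FiniteSupport

variable {d m ℓ n k : ℕ} {t : Fin k → TypeSpace d}

/-- The pair (type, action) with the type given by its index. -/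
def indexed (t : Fin k → TypeSpace d) (y : Fin k × Action m ℓ) : TypeSpace d × Action m ℓ :=
  (t y.1, y.2)

/-- A distributional strategy over finitely many types is carried by the indices of the types. -/
theorem exists_eq_map_indexed (hk : k ≠ 0) (ht : Function.Injective t)
    {q : Measure (TypeSpace d × Action m ℓ)} (hq : q ∈ strategies m ℓ (uniformMeasure t)) :
    ∃ w : Measure (Fin k × Action m ℓ), IsProbabilityMeasure w ∧ q = w.map (indexed t) ∧
      ∀ x, ∑ a, w.real {(x, a)} = (k : ℝ)⁻¹ := by
  classical
  obtain ⟨hq1, hq2⟩ := hq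
  have : Nonempty (Fin k) := ⟨⟨0, Nat.pos_of_ne_zero hk⟩⟩
  have hemb : MeasurableEmbedding t :=
    ⟨ht, Measurable.of_discrete, fun s _ => (s.toFinite.image t).measurableSet⟩
  -- `g` is a measurable left inverse of `t`, recovering the index of a type almost surely under
  -- `q`.
  obtain ⟨g, hg, hgt⟩ := hemb.exists_measurable_extend (measurable_id (α := Fin k))
    fun _ => inferInstance
  have hgt' : ∀ i, g (t i) = i := fun i => congrFun hgt i
  have hψ : Measurable fun y : TypeSpace d × Action m ℓ => (g y.1, y.2) :=
    (hg.comp measurable_fst).prodMk measurable_snd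
  have hφ : Measurable (indexed (m := m) (ℓ := ℓ) t) := Measurable.of_discrete
  refine ⟨q.map fun y => (g y.1, y.2), Measure.isProbabilityMeasure_map hψ.aemeasurable, ?_,
    fun x => ?_⟩
  · have hrange : MeasurableSet (Set.range t) := (Set.finite_range t).measurableSet
    have hae : ∀ᵐ y ∂q, y.1 ∈ Set.range t := by
      have h0 : q.map Prod.fst (Set.range t)ᶜ = 0 := by
        rw [hq2, uniformMeasure_apply _ hrange.compl]
        simp
      rwa [Measure.map_apply measurable_fst hrange.compl] at h0
    rw [Measure.map_map hφ hψ]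
    conv_lhs => rw [← Measure.map_id (μ := q)]
    refine Measure.map_congr ?_
    filter_upwards [hae] with y hy
    obtain ⟨i, hi⟩ := hy
    refine Prod.ext ?_ rfl
    simp only [id, indexed, Function.comp_apply, ← hi, hgt']
  · have hsum : ∑ a, (q.map fun y => (g y.1, y.2)).real {(x, a)} =
        (q.map fun y => (g y.1, y.2)).real (Prod.fst ⁻¹' {x}) := by
      have := Measure.isProbabilityMeasure_map (μ := q) hψ.aemeasurable
      rw [← Finset.sum_image (s := Finset.univ) (g := fun a : Action m ℓ => (x, a))
        (f := fun y => (q.map fun y => (g y.1, y.2)).real {y}) (fun a _ b _ h => (Prod.ext_iff.1 h).2),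
        sum_measureReal_singleton]
      congr 1
      ext ⟨y, b⟩
      simp [eq_comm]
    have hx : MeasurableSet (g ⁻¹' {x}) := hg (measurableSet_singleton x)
    rw [hsum, measureReal_def, Measure.map_apply hψ (measurable_fst (measurableSet_singleton x))]
    change (q (Prod.fst ⁻¹' (g ⁻¹' {x}))).toReal = _
    rw [← Measure.map_apply measurable_fst hx, hq2, uniformMeasure_apply _ hx,
      Finset.sum_eq_single x]
    · simp [hgt']
    · intro i _ hi
      simp [hgt', hi]
    · simp

theorem measurableEmbedding_indexed (ht : Function.Injective t) :
    MeasurableEmbedding fun (ω : Fin n → Fin k × Action m ℓ) i => indexed t (ω i) := by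
  refine ⟨fun ω ω' h => funext fun i => ?_, Measurable.of_discrete,
    fun s _ => (s.toFinite.image _).measurableSet⟩
  have := Prod.ext_iff.1 (congrFun h i)
  exact Prod.ext (ht this.1) this.2

/-- The index space is finite and discrete and embeds measurably, so `f` needs no measurability. -/
theorem integral_pi_map_indexed (ht : Function.Injective t)
    (w : Fin n → Measure (Fin k × Action m ℓ)) [∀ i, IsProbabilityMeasure (w i)]
    (f : (Fin n → TypeSpace d × Action m ℓ) → ℝ) :
    ∫ ta, f ta ∂(Measure.pi fun i => (w i).map (indexed t)) =
      ∑ ω : Fin n → Fin k × Action m ℓ, (∏ i, (w i).real {ω i}) * f fun i => indexed t (ω i) := by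
  have hφ : Measurable (indexed (m := m) (ℓ := ℓ) t) := Measurable.of_discrete
  have : ∀ i, IsProbabilityMeasure ((w i).map (indexed t)) := fun i =>
    Measure.isProbabilityMeasure_map hφ.aemeasurable
  rw [← Measure.pi_map_pi fun i => hφ.aemeasurable,
    (measurableEmbedding_indexed ht).integral_map, integral_fintype Integrable.of_finite]
  simp only [measureReal_def, Measure.pi_singleton, ENNReal.toReal_prod, smul_eq_mul]

/-- The profile of (type, action) pairs in which the types are `t (σ j)`, player `i` plays `b`
and the others play the actions prescribed by `a`. -/
def deviation (t : Fin k → TypeSpace d) (a : Fin k → Action m ℓ) (i : Fin n)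
    (σ : Fin n → Fin k) (b : Action m ℓ) (j : Fin n) : TypeSpace d × Action m ℓ :=
  (t (σ j), Function.update (fun j => a (σ j)) i b j)

/-- The expectation of `g` on the event that all types are distinct, when player `i` deviates from
a pure strategy `a`. -/
theorem integral_indicator_distinctTypes (hk : k ≠ 0) (ht : Function.Injective t)
    (a : Fin k → Action m ℓ) (i : Fin n) (w : Measure (Fin k × Action m ℓ))
    [IsProbabilityMeasure w] (g : (Fin n → TypeSpace d × Action m ℓ) → ℝ) :
    ∫ ta, (distinctTypes d m n ℓ).indicator g ta ∂(Measure.pi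
        (Function.update (fun _ : Fin n => uniformMeasure fun x => (t x, a x)) i
          (w.map (indexed t)))) =
      ((k : ℝ)⁻¹) ^ (n - 1) * ∑ x, ∑ b, w.real {(x, b)} *
        ∑ σ ∈ pointedInj i x, g (deviation t a i σ b) := by
  classical
  have hφ : Measurable (indexed (m := m) (ℓ := ℓ) t) := Measurable.of_discrete
  set u : Measure (Fin k × Action m ℓ) := uniformMeasure fun x => (x, a x) with hu
  have hup : IsProbabilityMeasure u := isProbabilityMeasure_uniformMeasure hk _
  have hmap : Function.update (fun _ : Fin n => uniformMeasure fun x => (t x, a x)) i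
      (w.map (indexed t)) = fun j => (Function.update (fun _ => u) i w j).map (indexed t) := by
    funext j
    rcases eq_or_ne j i with rfl | hj
    · simp
    · simp only [Function.update_of_ne hj, hu, map_uniformMeasure _ hφ]
      rfl
  have hprob : ∀ j, IsProbabilityMeasure (Function.update (fun _ : Fin n => u) i w j) := by
    intro j
    rcases eq_or_ne j i with rfl | hj
    · simpa
    · simpa [Function.update_of_ne hj]
  -- `e` parametrizes the profiles in which all opponents follow `a`; any other profile has weight
  -- zero.
  let e : (Fin n → Fin k) × Action m ℓ → (Fin n → Fin k × Action m ℓ) :=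
    fun P j => (P.1 j, Function.update (fun j => a (P.1 j)) i P.2 j)
  have he : Function.Injective e := by
    rintro ⟨σ, b⟩ ⟨σ', b'⟩ h
    refine Prod.ext (funext fun j => congrArg Prod.fst (congrFun h j)) ?_
    simpa [e] using congrArg Prod.snd (congrFun h i)
  have hprod : ∀ P, ∏ j, (Function.update (fun _ : Fin n => u) i w j).real {e P j} =
      w.real {(P.1 i, P.2)} * ((k : ℝ)⁻¹) ^ (n - 1) := by
    intro P
    rw [← Finset.mul_prod_erase _ _ (Finset.mem_univ i)]
    congr 1
    · simp [e]
    · rw [Finset.prod_congr rfl (g := fun _ => (k : ℝ)⁻¹), Finset.prod_const,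
        Finset.card_erase_of_mem (Finset.mem_univ i), Finset.card_univ, Fintype.card_fin]
      intro j hj
      have hj := Finset.ne_of_mem_erase hj
      simp only [Function.update_of_ne hj, e, hu]
      rw [uniformMeasure_graph_real_singleton, if_pos rfl]
  rw [hmap, integral_pi_map_indexed ht, ← Fintype.sum_of_injective e he
    (fun P => w.real {(P.1 i, P.2)} * ((k : ℝ)⁻¹) ^ (n - 1) *
      (distinctTypes d m n ℓ).indicator g (deviation t a i P.1 P.2)) _ ?_ ?_]
  · rw [Fintype.sum_prod_type, ← Finset.sum_fiberwise (s := Finset.univ)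
      (g := fun σ : Fin n → Fin k => σ i), Finset.mul_sum]
    refine Finset.sum_congr rfl fun x _ => ?_
    rw [Finset.sum_comm, Finset.mul_sum]
    refine Finset.sum_congr rfl fun b _ => ?_
    rw [Finset.mul_sum, Finset.mul_sum]
    have hsub : pointedInj i x ⊆ Finset.univ.filter fun σ : Fin n → Fin k => σ i = x :=
      Finset.monotone_filter_right _ fun σ _ h => h.2
    rw [← Finset.sum_subset hsub]
    · refine Finset.sum_congr rfl fun σ hσ => ?_
      rw [Set.indicator_of_mem (show deviation t a i σ b ∈ distinctTypes d m n ℓ from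
        ht.comp (Finset.mem_filter.1 hσ).2.1), ← (Finset.mem_filter.1 hσ).2.2]
      ring
    · intro σ hσ hσ'
      rw [Set.indicator_of_notMem, mul_zero]
      intro h
      refine hσ' (Finset.mem_filter.2 ⟨Finset.mem_univ σ, ?_, (Finset.mem_filter.1 hσ).2⟩)
      exact Function.Injective.of_comp (f := t) h
  · intro ω hω
    obtain ⟨j, hj, hne⟩ : ∃ j, j ≠ i ∧ (ω j).2 ≠ a (ω j).1 := by
      by_contra! hcon
      refine hω ⟨(fun j => (ω j).1, (ω i).2), funext fun j => Prod.ext rfl ?_⟩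
      rcases eq_or_ne j i with rfl | hj
      · simp [e]
      · simp [e, hj, hcon j hj]
    rw [Finset.prod_eq_zero (Finset.mem_univ j), zero_mul]
    rw [Function.update_of_ne hj, hu, uniformMeasure_graph_real_singleton, if_neg hne]
  · intro P
    rw [hprod]
    rfl

end FiniteSupport

/-! ### No profitable deviation -/

section Equilibrium

variable {d m : ℕ} (G : Market d m) {n k : ℕ} {t : Fin k → TypeSpace d} {a : Fin k → Fin m}

/-- The total utility, over all ways to draw distinct types with `x` for player `i`, of an
application to school `j`, when the others apply to the schools prescribed by `a`. -/
theorem sum_utility_deviation_single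
    (hdistinct : ∀ j : Fin m, Function.Injective fun i => G.score j (t i)) (i : Fin n) (x : Fin k)
    (j : Fin m) :
    ∑ σ ∈ pointedInj i x,
        G.utility (deviation t (fun y => Action.single (a y)) i σ (Action.single j)) i =
      G.value j (t x) * (((pointedInj i x).filter fun σ => (Finset.univ.filter fun i' =>
        σ i' ∈ Finset.univ.filter fun y =>
          a y = j ∧ G.score j (t x) < G.score j (t y)).card < G.capacity j).card : ℝ) := by
  rw [Finset.card_filter, Nat.cast_sum, Finset.mul_sum]
  refine Finset.sum_congr rfl fun σ hσ => ?_
  obtain ⟨-, hinj, rfl⟩ := Finset.mem_filter.1 hσ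
  rw [G.utility_of_singleton (j := j) (by simp only [deviation, Function.update_self]; rfl)
    ((hdistinct j).comp hinj)]
  have hset : (Finset.univ.filter fun i' =>
      (deviation t (fun y => Action.single (a y)) i σ (Action.single j) i').2.1 = [j] ∧
        G.score j (deviation t (fun y => Action.single (a y)) i σ (Action.single j) i).1 <
          G.score j (deviation t (fun y => Action.single (a y)) i σ (Action.single j) i').1) =
      Finset.univ.filter fun i' => σ i' ∈ Finset.univ.filter fun y =>
          a y = j ∧ G.score j (t (σ i)) < G.score j (t y) := by
    refine Finset.filter_congr fun i' _ => ?_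
    simp only [deviation, Finset.mem_filter, Finset.mem_univ, true_and]
    rcases eq_or_ne i' i with rfl | hi'
    · simp
    · rw [Function.update_of_ne hi']
      simp [Action.single]
  rw [hset]
  simp [deviation]

/-- No type has a profitable deviation from the assignment computed by the algorithm. -/
theorem sum_utility_deviation_le (hnk : n ≤ k)
    (hdistinct : ∀ j : Fin m, Function.Injective fun i => G.score j (t i))
    {st : GreedyState k m} (hst : G.GreedyInvariant n t st)
    (ha : ∀ i, st.school i = some (a i)) (i : Fin n) (x : Fin k) (b : Action m 1) :
    ∑ σ ∈ pointedInj i x, G.utility (deviation t (fun y => Action.single (a y)) i σ b) i ≤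
      ∑ σ ∈ pointedInj i x,
        G.utility (deviation t (fun y => Action.single (a y)) i σ (Action.single (a x))) i := by
  have hb : b.1 = [] ∨ ∃ j, b = Action.single j := by
    obtain ⟨l, hl, hl'⟩ := b
    rcases l with _ | ⟨j, _ | ⟨j', l⟩⟩
    · exact Or.inl rfl
    · exact Or.inr ⟨j, rfl⟩
    · simp at hl'
  rcases hb with hb | ⟨j, rfl⟩
  · rw [Finset.sum_eq_zero, G.sum_utility_deviation_single hdistinct]
    · exact mul_nonneg (G.value_nonneg _ _) (Nat.cast_nonneg _)
    · intro σ _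
      exact G.utility_of_nil (by simpa [deviation] using hb)
  obtain ⟨B, hsub, heq, hle⟩ := hst.exists_witness_of_school_eq G ha x
  obtain ⟨K, hK, hcard⟩ := exists_card_filter_lt_eq_mul_proba hnk i x
  have hx : ∀ j, x ∉ B j := fun j h => by simpa using hsub j h
  rw [G.sum_utility_deviation_single hdistinct, G.sum_utility_deviation_single hdistinct, ← heq,
    hcard _ _ (hx _)]
  -- The deviator faces at least the rivals in `B j`, so replacing them by `B j` can only enlarge
  -- the acceptance event.
  calc _ ≤ G.value j (t x) * (((pointedInj i x).filter fun σ =>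
          (Finset.univ.filter fun i' => σ i' ∈ B j).card < G.capacity j).card : ℝ) := by
        refine mul_le_mul_of_nonneg_left (Nat.cast_le.2 (Finset.card_le_card ?_))
          (G.value_nonneg _ _)
        refine Finset.monotone_filter_right _ fun σ _ h => lt_of_le_of_lt ?_ h
        exact Finset.card_le_card (Finset.monotone_filter_right _ fun i' _ h' => hsub j h')
    _ = K * (G.value j (t x) * proba k n (B j).card (G.capacity j)) := by
        rw [hcard _ _ (hx _)]
        ring
    _ ≤ K * (G.value (a x) (t x) * proba k n (B (a x)).card (G.capacity (a x))) :=
        mul_le_mul_of_nonneg_left (hle j) hK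
    _ = _ := by ring

theorem isSymmetricEquilibrium_of_greedyReturns (hn : 1 ≤ n) (hnk : n ≤ k)
    (hdistinct : ∀ j : Fin m, Function.Injective fun i => G.score j (t i))
    {p : Measure (TypeSpace d × Action m 1)} (hp : G.GreedyReturns n t p) :
    G.IsSymmetricEquilibrium n (uniformMeasure t) p := by
  classical
  obtain ⟨st, a, hwhile, ha, rfl⟩ := hp
  have hst := (G.greedyInvariant_init n t).greedyWhile G hdistinct hwhile
  have hk : k ≠ 0 := by omega
  have ht : Function.Injective t := fun x y h =>
    hdistinct (a x) (congrArg (G.score (a x)) h)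
  have hmem : uniformMeasure (fun x => (t x, Action.single (a x))) ∈
      strategies m 1 (uniformMeasure t) :=
    ⟨isProbabilityMeasure_uniformMeasure hk _, map_uniformMeasure _ measurable_fst⟩
  refine ⟨hmem, fun _ => hmem, fun i q hq => ?_⟩
  obtain ⟨w, hw, rfl, hmarg⟩ := exists_eq_map_indexed hk ht hq
  have hu : IsProbabilityMeasure (uniformMeasure fun x => (x, Action.single (a x))) :=
    isProbabilityMeasure_uniformMeasure hk _
  -- Viewing the equilibrium profile as a trivial deviation lets one formula compute both payoffs.
  have hself : (fun _ : Fin n => uniformMeasure fun x => (t x, Action.single (a x))) =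
      Function.update (fun _ : Fin n => uniformMeasure fun x => (t x, Action.single (a x))) i
        ((uniformMeasure fun x => (x, Action.single (a x))).map (indexed t)) := by
    rw [map_uniformMeasure _ Measurable.of_discrete]
    exact (Function.update_eq_self i _).symm
  conv_rhs => rw [hself]
  unfold payoff
  simp only [integral_indicator_distinctTypes hk ht]
  have hmarg' : ∀ x, ∑ b, (uniformMeasure fun x => (x, Action.single (a x))).real {(x, b)} =
      (k : ℝ)⁻¹ := by
    intro x
    simp only [uniformMeasure_graph_real_singleton]
    simp
  have hden : ∀ v : Measure (Fin k × Action m 1), (∀ x, ∑ b, v.real {(x, b)} = (k : ℝ)⁻¹) →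
      ∑ x, ∑ b, v.real {(x, b)} * ∑ σ ∈ pointedInj i x, (1 : ℝ) =
        ∑ x : Fin k, (k : ℝ)⁻¹ * ∑ σ ∈ pointedInj i x, (1 : ℝ) := by
    intro v hv
    refine Finset.sum_congr rfl fun x _ => ?_
    rw [← Finset.sum_mul, hv]
  rw [hden _ hmarg, hden _ hmarg']
  refine div_le_div_of_nonneg_right (mul_le_mul_of_nonneg_left (Finset.sum_le_sum fun x _ => ?_)
    (by positivity)) (by positivity)
  simp only [uniformMeasure_graph_real_singleton, ite_mul, zero_mul, Finset.sum_ite_eq',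
    Finset.mem_univ, if_true]
  -- The weight `1/k` of type `x` is split over the deviator's actions, each bounded by the
  -- prescribed one.
  rw [← hmarg x, Finset.sum_mul]
  exact Finset.sum_le_sum fun b _ => mul_le_mul_of_nonneg_left
    (G.sum_utility_deviation_le hnk hdistinct hst ha i x b) measureReal_nonneg

end Equilibrium

end Market

end SchoolChoice

theorem mainTheorem2 {d m : ℕ} (G : SchoolChoice.Market d m) (n k : ℕ) (hn : 1 ≤ n) (hnk : n ≤ k)
    (t : Fin k → SchoolChoice.TypeSpace d)
    (hdistinct : ∀ j : Fin m, Function.Injective fun i => G.score j (t i))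
    (hred : G.StronglyAlphaReducible) :
    (∃ p, G.GreedyReturns n t p) ∧
      ∀ p, G.GreedyReturns n t p →
        G.IsSymmetricEquilibrium n (SchoolChoice.Market.uniformMeasure t) p :=
  ⟨G.exists_greedyReturns hred hdistinct,
    fun _ hp => G.isSymmetricEquilibrium_of_greedyReturns hn hnk hdistinct hp⟩
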